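/- Let $A$ be a unital $C^*$-algebra and let $(A,\Delta)$ be a $C^*$-algebraic compact quantum group: $\Delta:A\to A\otimes A$ (minimal tensor product) is a unital $*$-homomorphism with $(\Delta\otimes\mathrm{id})\Delta=(\mathrm{id}\otimes\Delta)\Delta$ such that the linear spans of $\{(a\otimes 1)\Delta(b): a,b\in A\}$ and of $\{(1\otimes a)\Delta(b): a,b\in A\}$ are norm dense in $A\otimes A$. Let $(X,d)$ be a compact metric space and let $\rho:C(X)\to C(X)\otimes A$ be an action of $(A,\Delta)$ on $X$, that is, a unital $*$-homomorphism with $(\rho\otimes\mathrm{id})\rho=(\mathrm{id}\otimes\Delta)\rho$ such that the linear span of $\{(1\otimes a)\rho(f): a\in A,\ f\in C(X)\}$ is norm dense in $C(X)\otimes A$. For a Borel probability measure $\mu$ on $X$ and a state $\psi$ of $A$, let $\mu\triangleleft\psi$ be the Borel probability measure on $X$ with $\int_X f\,d(\mu\triangleleft\psi)=(\mu\otimes\psi)(\rho(f))$ for all $f\in C(X)$; for $x\in X$ write $x\triangleleft\psi=\delta_x\triangleleft\psi$. For real $p\ge 1$ let $$W_p(\mu,\nu)=\inf_{\pi}\Big(\int_{X\times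 X}d(x,y)^p\,d\pi(x,y)\Big)^{1/p},$$ where $\pi$ ranges over the Borel probability measures on $X\times X$ with marginals $\mu$ and $\nu$. Then for every real $p\ge 1$ the following two conditions are equivalent: 1. (Lip$_p$): $W_p(\mu\triangleleft\psi,\nu\triangleleft\psi)\le W_p(\mu,\nu)$ for all Borel probability measures $\mu,\nu$ on $X$ and all states $\psi$ of $A$; 2. $W_p(x\triangleleft\psi,y\triangleleft\psi)\le d(x,y)$ for all $x,y\in X$ and all states $\psi$ of $A$. -/

import Mathlib

open scoped TensorProduct ENNReal ComplexOrder CompactlySupported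
open UniformSpace MeasureTheory

universe u

noncomputable section

namespace CQG

/-! ### Hilbert space tensor products -/

section Hilbert

variable (H K L : Type*)
  [NormedAddCommGroup H] [InnerProductSpace ℂ H]
  [NormedAddCommGroup K] [InnerProductSpace ℂ K]
  [NormedAddCommGroup L] [InnerProductSpace ℂ L]

/-- The Hilbert space tensor product. -/
abbrev HTensor : Type _ := Completion (H ⊗[ℂ] K)

variable {H K L}

/-- The elementary tensor `x ⊗ y`. -/
def htmul (x : H) (y : K) : HTensor H K := ((x ⊗ₜ[ℂ] y : H ⊗[ℂ] K) : Completion (H ⊗[ℂ] K))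

theorem inner_htmul (x x' : H) (y y' : K) :
    inner ℂ (htmul x y) (htmul x' y') = inner ℂ x x' * inner ℂ y y' := by
  simp [htmul]

theorem norm_htmul (x : H) (y : K) : ‖htmul x y‖ = ‖x‖ * ‖y‖ := by
  simp [htmul]

instance [Nontrivial H] [Nontrivial K] : Nontrivial (HTensor H K) := by
  obtain ⟨x, hx⟩ := exists_ne (0 : H)
  obtain ⟨y, hy⟩ := exists_ne (0 : K)
  refine ⟨htmul x y, 0, fun h => ?_⟩
  have := norm_htmul x y
  rw [h, norm_zero] at this
  simp_all

/-- The operator `S ⊗ T` on the Hilbert space tensor product. -/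
def opTensor (S : H →L[ℂ] H) (T : K →L[ℂ] K) : HTensor H K →L[ℂ] HTensor H K :=
  (TensorProduct.mapL S T).completion

@[simp]
theorem opTensor_coe (S : H →L[ℂ] H) (T : K →L[ℂ] K) (v : H ⊗[ℂ] K) :
    opTensor S T (v : Completion (H ⊗[ℂ] K)) = (TensorProduct.mapL S T v : H ⊗[ℂ] K) := by
  simp only [opTensor, ContinuousLinearMap.completion_apply_coe]

theorem htensor_op_ext {V : Type*} [NormedAddCommGroup V] [NormedSpace ℂ V]
    {S T : HTensor H K →L[ℂ] V} (h : ∀ v : H ⊗[ℂ] K, S v = T v) : S = T := by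
  ext v
  induction v using Completion.induction_on with
  | hp => exact isClosed_eq S.continuous T.continuous
  | ih v => exact h v

@[simp]
theorem opTensor_htmul (S : H →L[ℂ] H) (T : K →L[ℂ] K) (x : H) (y : K) :
    opTensor S T (htmul x y) = htmul (S x) (T y) := by
  simp [htmul]

theorem opTensor_one : opTensor (1 : H →L[ℂ] H) (1 : K →L[ℂ] K) = 1 := by
  refine htensor_op_ext fun v => ?_
  have : TensorProduct.mapL (1 : H →L[ℂ] H) (1 : K →L[ℂ] K) = 1 := TensorProduct.mapL_id_id
  simp only [opTensor_coe, this, one_apply_eq_self]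

theorem opTensor_mul (S S' : H →L[ℂ] H) (T T' : K →L[ℂ] K) :
    opTensor (S * S') (T * T') = opTensor S T * opTensor S' T' := by
  refine htensor_op_ext fun v => ?_
  simp only [opTensor_coe, TensorProduct.mapL_mul, mul_apply_eq_comp]

theorem opTensor_add_left (S S' : H →L[ℂ] H) (T : K →L[ℂ] K) :
    opTensor (S + S') T = opTensor S T + opTensor S' T := by
  refine htensor_op_ext fun v => ?_
  simp only [opTensor_coe, TensorProduct.mapL_add_left, _root_.add_apply,
    Completion.coe_add]

theorem opTensor_add_right (S : H →L[ℂ] H) (T T' : K →L[ℂ] K) :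
    opTensor S (T + T') = opTensor S T + opTensor S T' := by
  refine htensor_op_ext fun v => ?_
  simp only [opTensor_coe, TensorProduct.mapL_add_right, _root_.add_apply,
    Completion.coe_add]

theorem opTensor_smul_left (c : ℂ) (S : H →L[ℂ] H) (T : K →L[ℂ] K) :
    opTensor (c • S) T = c • opTensor S T := by
  refine htensor_op_ext fun v => ?_
  simp only [opTensor_coe, TensorProduct.mapL_smul_left, _root_.smul_apply,
    Completion.coe_smul]

theorem opTensor_smul_right (c : ℂ) (S : H →L[ℂ] H) (T : K →L[ℂ] K) :
    opTensor S (c • T) = c • opTensor S T := by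
  refine htensor_op_ext fun v => ?_
  simp only [opTensor_coe, TensorProduct.mapL_smul_right, _root_.smul_apply,
    Completion.coe_smul]

theorem norm_opTensor_le (S : H →L[ℂ] H) (T : K →L[ℂ] K) :
    ‖opTensor S T‖ ≤ ‖S‖ * ‖T‖ := by
  refine ContinuousLinearMap.opNorm_le_bound _ (by positivity) fun v => ?_
  induction v using Completion.induction_on with
  | hp => exact isClosed_le (by fun_prop) (by fun_prop)
  | ih v =>
    rw [opTensor_coe, Completion.norm_coe, Completion.norm_coe]
    exact (TensorProduct.mapL S T).le_of_opNorm_le (TensorProduct.norm_mapL_le S T) v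

theorem star_opTensor [CompleteSpace H] [CompleteSpace K] (S : H →L[ℂ] H) (T : K →L[ℂ] K) :
    star (opTensor S T) = opTensor (star S) (star T) := by
  rw [ContinuousLinearMap.star_eq_adjoint, eq_comm, ContinuousLinearMap.eq_adjoint_iff]
  intro x y
  induction x, y using Completion.induction_on₂ with
  | hp => exact isClosed_eq (by fun_prop) (by fun_prop)
  | ih x y =>
    simp only [opTensor_coe, Completion.inner_coe]
    induction x using TensorProduct.induction_on with
    | zero => simp
    | add x x' hx hx' => simp only [map_add, inner_add_left, hx, hx']
    | tmul a b =>
      induction y using TensorProduct.induction_on with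
      | zero => simp
      | add y y' hy hy' => simp only [map_add, inner_add_right, hy, hy']
      | tmul c d =>
        simp [ContinuousLinearMap.star_eq_adjoint, ContinuousLinearMap.adjoint_inner_left]

/-- `(x ⊗ y) ⊗ z ↦ (x ⊗ y) ⊗ z` from the algebraic to the Hilbert space tensor product. -/
def assocLeft : (H ⊗[ℂ] K) ⊗[ℂ] L →ₗᵢ[ℂ] HTensor (HTensor H K) L :=
  Completion.toComplₗᵢ.comp (TensorProduct.mapIsometry Completion.toComplₗᵢ LinearIsometry.id)

/-- `x ⊗ (y ⊗ z) ↦ x ⊗ (y ⊗ z)` from the algebraic to the Hilbert space tensor product. -/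
def assocRight : H ⊗[ℂ] (K ⊗[ℂ] L) →ₗᵢ[ℂ] HTensor H (HTensor K L) :=
  Completion.toComplₗᵢ.comp (TensorProduct.mapIsometry LinearIsometry.id Completion.toComplₗᵢ)

theorem denseRange_assocLeft : DenseRange (assocLeft (H := H) (K := K) (L := L)) := by
  refine Completion.denseRange_coe.comp
    (f := TensorProduct.mapIsometry (Completion.toComplₗᵢ (𝕜 := ℂ) (E := H ⊗[ℂ] K))
      (LinearIsometry.id (R := ℂ) (E := L))) ?_ (Completion.continuous_coe _)
  intro v
  change v ∈ closure (LinearMap.range (TensorProduct.mapIsometry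
    (Completion.toComplₗᵢ (𝕜 := ℂ) (E := H ⊗[ℂ] K))
      (LinearIsometry.id (R := ℂ) (E := L))).toLinearMap : Set _)
  rw [← Submodule.topologicalClosure_coe, SetLike.mem_coe]
  induction v using TensorProduct.induction_on with
  | zero => exact zero_mem _
  | add x y hx hy => exact add_mem hx hy
  | tmul a l =>
    induction a using Completion.induction_on with
    | hp =>
      exact (Submodule.isClosed_topologicalClosure _).preimage
        (TensorProduct.continuous_tmul.comp (Continuous.prodMk_left l))
    | ih a => exact Submodule.le_topologicalClosure _ ⟨a ⊗ₜ l, rfl⟩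

theorem denseRange_assocRight : DenseRange (assocRight (H := H) (K := K) (L := L)) := by
  refine Completion.denseRange_coe.comp
    (f := TensorProduct.mapIsometry (LinearIsometry.id (R := ℂ) (E := H))
      (Completion.toComplₗᵢ (𝕜 := ℂ) (E := K ⊗[ℂ] L))) ?_ (Completion.continuous_coe _)
  intro v
  change v ∈ closure (LinearMap.range (TensorProduct.mapIsometry
    (LinearIsometry.id (R := ℂ) (E := H))
      (Completion.toComplₗᵢ (𝕜 := ℂ) (E := K ⊗[ℂ] L))).toLinearMap : Set _)
  rw [← Submodule.topologicalClosure_coe, SetLike.mem_coe]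
  induction v using TensorProduct.induction_on with
  | zero => exact zero_mem _
  | add x y hx hy => exact add_mem hx hy
  | tmul h a =>
    induction a using Completion.induction_on with
    | hp =>
      exact (Submodule.isClosed_topologicalClosure _).preimage
        (TensorProduct.continuous_tmul.comp (Continuous.prodMk_right h))
    | ih a => exact Submodule.le_topologicalClosure _ ⟨h ⊗ₜ a, rfl⟩

/-- The associativity unitary `(x ⊗ y) ⊗ z ↦ x ⊗ (y ⊗ z)`. -/
def hassoc : HTensor (HTensor H K) L ≃ₗᵢ[ℂ] HTensor H (HTensor K L) :=
  LinearEquiv.extendOfIsometry (TensorProduct.assocIsometry ℂ H K L).toLinearEquiv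
    assocLeft.toLinearMap assocRight.toLinearMap denseRange_assocLeft denseRange_assocRight
    (fun x => by simp)

theorem hassoc_htmul (x : H) (y : K) (z : L) :
    hassoc (htmul (htmul x y) z) = htmul x (htmul y z) :=
  LinearMap.extendOfNorm_eq (f := assocRight.toLinearMap ∘ₗ
      (TensorProduct.assocIsometry ℂ H K L).toLinearEquiv.toLinearMap)
    (e := assocLeft.toLinearMap) denseRange_assocLeft
    ⟨1, fun x => by
      simpa using (assocRight.norm_map (TensorProduct.assoc ℂ H K L x)).le⟩ ((x ⊗ₜ y) ⊗ₜ z)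

variable [CompleteSpace H] [CompleteSpace K]

/-- The unital `*`-homomorphism `S ↦ S ⊗ 1`. -/
def amplLeft : (H →L[ℂ] H) →⋆ₐ[ℂ] (HTensor H K →L[ℂ] HTensor H K) where
  toFun S := opTensor S 1
  map_one' := opTensor_one
  map_mul' S S' := by rw [← opTensor_mul, one_mul]
  map_zero' := by simpa using opTensor_smul_left (0 : ℂ) (0 : H →L[ℂ] H) (1 : K →L[ℂ] K)
  map_add' S S' := opTensor_add_left S S' 1
  commutes' c := by
    rw [Algebra.algebraMap_eq_smul_one, Algebra.algebraMap_eq_smul_one, opTensor_smul_left,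
      opTensor_one]
  map_star' S := by rw [star_opTensor, star_one]

/-- The unital `*`-homomorphism `T ↦ 1 ⊗ T`. -/
def amplRight : (K →L[ℂ] K) →⋆ₐ[ℂ] (HTensor H K →L[ℂ] HTensor H K) where
  toFun T := opTensor 1 T
  map_one' := opTensor_one
  map_mul' T T' := by rw [← opTensor_mul, one_mul]
  map_zero' := by simpa using opTensor_smul_right (0 : ℂ) (1 : H →L[ℂ] H) (0 : K →L[ℂ] K)
  map_add' T T' := opTensor_add_right 1 T T'
  commutes' c := by
    rw [Algebra.algebraMap_eq_smul_one, Algebra.algebraMap_eq_smul_one, opTensor_smul_right,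
      opTensor_one]
  map_star' T := by rw [star_opTensor, star_one]

theorem amplLeft_mul_amplRight (S : H →L[ℂ] H) (T : K →L[ℂ] K) :
    amplLeft S * amplRight T = opTensor S T := by
  change opTensor S 1 * opTensor 1 T = _
  rw [← opTensor_mul, mul_one, one_mul]

end Hilbert

/-- A nonzero complex Hilbert space. -/
structure Hilb : Type (u + 1) where
  /-- the underlying type -/
  carrier : Type u
  [instNACG : NormedAddCommGroup carrier]
  [instIPS : InnerProductSpace ℂ carrier]
  [instComplete : CompleteSpace carrier]
  [instNontrivial : Nontrivial carrier]

attribute [instance] Hilb.instNACG Hilb.instIPS Hilb.instComplete Hilb.instNontrivial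

instance : CoeSort Hilb.{u} (Type u) := ⟨Hilb.carrier⟩

namespace Hilb

variable {H K L : Hilb.{u}}

/-- The Hilbert space tensor product of two nonzero Hilbert spaces. -/
def tensor (H K : Hilb.{u}) : Hilb.{u} := ⟨HTensor H K⟩

/-- The elementary tensor `x ⊗ y`. -/
def tmul (x : H) (y : K) : H.tensor K := htmul x y

theorem inner_tmul (x x' : H) (y y' : K) :
    inner ℂ (tmul x y) (tmul x' y') = inner ℂ x x' * inner ℂ y y' := inner_htmul x x' y y'

/-- The operator `S ⊗ T`. -/
def op (S : H →L[ℂ] H) (T : K →L[ℂ] K) : H.tensor K →L[ℂ] H.tensor K := opTensor S T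

theorem op_tmul (S : H →L[ℂ] H) (T : K →L[ℂ] K) (x : H) (y : K) :
    op S T (tmul x y) = tmul (S x) (T y) := opTensor_htmul S T x y

/-- The unital `*`-homomorphism `S ↦ S ⊗ 1`. -/
def left (H K : Hilb.{u}) : (H →L[ℂ] H) →⋆ₐ[ℂ] (H.tensor K →L[ℂ] H.tensor K) :=
  amplLeft (H := H) (K := K)

/-- The unital `*`-homomorphism `T ↦ 1 ⊗ T`. -/
def right (H K : Hilb.{u}) : (K →L[ℂ] K) →⋆ₐ[ℂ] (H.tensor K →L[ℂ] H.tensor K) :=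
  amplRight (H := H) (K := K)

theorem left_mul_right (S : H →L[ℂ] H) (T : K →L[ℂ] K) : left H K S * right H K T = op S T :=
  amplLeft_mul_amplRight S T

/-- The associativity unitary `(H ⊗ K) ⊗ L ≃ H ⊗ (K ⊗ L)`. -/
def assoc (H K L : Hilb.{u}) : (H.tensor K).tensor L ≃ₗᵢ[ℂ] H.tensor (K.tensor L) :=
  hassoc (H := H) (K := K) (L := L)

theorem assoc_tmul (x : H) (y : K) (z : L) :
    assoc H K L (tmul (tmul x y) z) = tmul x (tmul y z) := hassoc_htmul x y z

end Hilb

/-! ### Bounded families of operators -/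

section Family

variable {I : Type*} (H : I → Hilb.{u})

/-- The `C*`-algebra of norm bounded families of operators on the Hilbert spaces `H i`. -/
def Fam : Type _ := lp (fun i => H i →L[ℂ] H i) ∞

instance : CStarAlgebra (Fam H) where
  __ := (inferInstance : NormedRing (lp (fun i => H i →L[ℂ] H i) ∞))
  __ := (inferInstance : NormedAlgebra ℂ (lp (fun i => H i →L[ℂ] H i) ∞))
  __ := (inferInstance : StarRing (lp (fun i => H i →L[ℂ] H i) ∞))
  __ := (inferInstance : StarModule ℂ (lp (fun i => H i →L[ℂ] H i) ∞))
  __ := (inferInstance : CompleteSpace (lp (fun i => H i →L[ℂ] H i) ∞))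
  __ := (inferInstance : CStarRing (lp (fun i => H i →L[ℂ] H i) ∞))

variable {H}

/-- The component at `i` of a bounded family. -/
def Fam.eval (i : I) : Fam H →⋆ₐ[ℂ] (H i →L[ℂ] H i) where
  toFun T := (show lp (fun i => H i →L[ℂ] H i) ∞ from T) i
  map_one' := rfl
  map_mul' _ _ := rfl
  map_zero' := rfl
  map_add' _ _ := rfl
  commutes' _ := rfl
  map_star' _ := rfl

theorem Fam.ext {S T : Fam H} (h : ∀ i, Fam.eval i S = Fam.eval i T) : S = T :=
  lp.ext (funext h)

/-- The `*`-homomorphism into bounded families with given components. -/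
def Fam.lift {A : Type*} [CStarAlgebra A] (f : ∀ i, A →⋆ₐ[ℂ] (H i →L[ℂ] H i)) :
    A →⋆ₐ[ℂ] Fam H where
  toFun a := (⟨fun i => f i a, memℓp_infty ⟨‖a‖, by
    rintro _ ⟨i, rfl⟩
    exact NonUnitalStarAlgHom.norm_apply_le (f i) a⟩⟩ : lp (fun i => H i →L[ℂ] H i) ∞)
  map_one' := Fam.ext fun i => map_one (f i)
  map_mul' a b := Fam.ext fun i => map_mul (f i) a b
  map_zero' := Fam.ext fun i => map_zero (f i)
  map_add' a b := Fam.ext fun i => map_add (f i) a b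
  commutes' c := Fam.ext fun i => AlgHomClass.commutes (f i) c
  map_star' a := Fam.ext fun i => map_star (f i) a

@[simp]
theorem Fam.eval_lift {A : Type*} [CStarAlgebra A] (f : ∀ i, A →⋆ₐ[ℂ] (H i →L[ℂ] H i)) (i : I)
    (a : A) : Fam.eval i (Fam.lift f a) = f i a := rfl

end Family

/-! ### Representations and the minimal tensor product -/

/-- A (unital) representation of a `C*`-algebra on a nonzero Hilbert space. -/
structure Rep (A : Type u) [CStarAlgebra A] : Type (u + 1) where
  /-- the Hilbert space -/
  H : Hilb.{u}
  /-- the action on the Hilbert space -/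
  π : A →⋆ₐ[ℂ] (H →L[ℂ] H)

section MinTensor

variable (A B C : Type u) [CStarAlgebra A] [CStarAlgebra B] [CStarAlgebra C]

/-- Bounded families of operators, one on `H ⊗ K` for each pair of representations of `A` on `H`
and of `B` on `K`. -/
def Amb2 : Type (u + 1) := Fam fun p : Rep A × Rep B => p.1.H.tensor p.2.H

instance : CStarAlgebra (Amb2 A B) :=
  inferInstanceAs (CStarAlgebra (Fam fun p : Rep A × Rep B => p.1.H.tensor p.2.H))

/-- Bounded families of operators, one on `(H ⊗ K) ⊗ L` for each triple of representations of `A`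
on `H`, of `B` on `K` and of `C` on `L`. -/
def Amb3 : Type (u + 1) :=
  Fam fun p : Rep A × Rep B × Rep C => (p.1.H.tensor p.2.1.H).tensor p.2.2.H

instance : CStarAlgebra (Amb3 A B C) :=
  inferInstanceAs (CStarAlgebra (Fam fun p : Rep A × Rep B × Rep C =>
    (p.1.H.tensor p.2.1.H).tensor p.2.2.H))

variable {A B C}

/-- `a ⊗ 1`, as the family of the operators `π a ⊗ 1`. -/
def amb2Left : A →⋆ₐ[ℂ] Amb2 A B := Fam.lift fun p => (Hilb.left p.1.H p.2.H).comp p.1.π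

/-- `1 ⊗ b`, as the family of the operators `1 ⊗ σ b`. -/
def amb2Right : B →⋆ₐ[ℂ] Amb2 A B := Fam.lift fun p => (Hilb.right p.1.H p.2.H).comp p.2.π

/-- `a ⊗ 1 ⊗ 1`, as the family of the operators `π a ⊗ 1 ⊗ 1`. -/
def amb3One : A →⋆ₐ[ℂ] Amb3 A B C := Fam.lift fun p =>
  ((Hilb.left (p.1.H.tensor p.2.1.H) p.2.2.H).comp (Hilb.left p.1.H p.2.1.H)).comp p.1.π

/-- `1 ⊗ b ⊗ 1`, as the family of the operators `1 ⊗ σ b ⊗ 1`. -/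
def amb3Two : B →⋆ₐ[ℂ] Amb3 A B C := Fam.lift fun p =>
  ((Hilb.left (p.1.H.tensor p.2.1.H) p.2.2.H).comp (Hilb.right p.1.H p.2.1.H)).comp p.2.1.π

/-- `1 ⊗ 1 ⊗ c`, as the family of the operators `1 ⊗ 1 ⊗ τ c`. -/
def amb3Three : C →⋆ₐ[ℂ] Amb3 A B C := Fam.lift fun p =>
  (Hilb.right (p.1.H.tensor p.2.1.H) p.2.2.H).comp p.2.2.π

variable (A B C)

/-- The minimal tensor product `A ⊗ B`: the closure of the linear combinations of elementary
tensors `a ⊗ b = (π a ⊗ σ b)_{π, σ}` in the norm `sup_{π, σ} ‖(π ⊗ σ)(t)‖`, where `π` and `σ`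
range over all representations of `A` and `B`. -/
def minTensor : StarSubalgebra ℂ (Amb2 A B) :=
  (StarAlgebra.adjoin ℂ {t | ∃ a b, t = amb2Left a * amb2Right b}).topologicalClosure

/-- The threefold minimal tensor product `A ⊗ B ⊗ C`: the closure of the linear combinations of
elementary tensors `a ⊗ b ⊗ c = (π a ⊗ σ b ⊗ τ c)_{π, σ, τ}` in the norm
`sup_{π, σ, τ} ‖(π ⊗ σ ⊗ τ)(t)‖`. -/
def minTensor3 : StarSubalgebra ℂ (Amb3 A B C) :=
  (StarAlgebra.adjoin ℂ
    {t | ∃ a b c, t = amb3One a * amb3Two b * amb3Three c}).topologicalClosure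

/-- The minimal tensor product `A ⊗ B`. -/
abbrev MinTensor : Type (u + 1) := minTensor A B

/-- The minimal tensor product `A ⊗ B ⊗ C`. -/
abbrev MinTensor3 : Type (u + 1) := minTensor3 A B C

instance isClosed_minTensor : IsClosed (minTensor A B : Set (Amb2 A B)) :=
  StarSubalgebra.isClosed_topologicalClosure _

instance isClosed_minTensor3 : IsClosed (minTensor3 A B C : Set (Amb3 A B C)) :=
  StarSubalgebra.isClosed_topologicalClosure _

variable {A B C}

instance : CStarAlgebra (MinTensor A B) := StarSubalgebra.cstarAlgebra (minTensor A B)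

instance : CStarAlgebra (MinTensor3 A B C) := StarSubalgebra.cstarAlgebra (minTensor3 A B C)

end MinTensor

theorem Hilb.ext_tmul {H K V : Hilb.{u}} {S T : H.tensor K →L[ℂ] V}
    (h : ∀ x y, S (Hilb.tmul x y) = T (Hilb.tmul x y)) : S = T := by
  refine htensor_op_ext (H := H) (K := K) fun v => ?_
  induction v using TensorProduct.induction_on with
  | zero => exact (map_zero S).trans (map_zero T).symm
  | add v w hv hw =>
    rw [Completion.coe_add]
    exact (map_add S _ _).trans ((congrArg₂ (· + ·) hv hw).trans (map_add T _ _).symm)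
  | tmul x y => exact h x y

/-- `x ↦ x ⊗ y` as a continuous linear map. -/
def Hilb.tmulRight {H K : Hilb.{u}} (y : K) : H →L[ℂ] H.tensor K :=
  (Completion.toComplL (𝕜 := ℂ) (E := H ⊗[ℂ] K)).comp ((TensorProduct.mkL ℂ H K).flip y)

theorem Hilb.ext_tmul_tmul {H K L V : Hilb.{u}} {S T : (H.tensor K).tensor L →L[ℂ] V}
    (h : ∀ x y z, S (Hilb.tmul (Hilb.tmul x y) z) = T (Hilb.tmul (Hilb.tmul x y) z)) : S = T := by
  refine Hilb.ext_tmul fun v z => ?_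
  have : S.comp (Hilb.tmulRight z) = T.comp (Hilb.tmulRight z) :=
    Hilb.ext_tmul fun x y => h x y z
  exact DFunLike.congr_fun this v

/-- The identification of operators on `H ⊗ (K ⊗ L)` with operators on `(H ⊗ K) ⊗ L`. -/
def Hilb.reassoc (H K L : Hilb.{u}) :
    (H.tensor (K.tensor L) →L[ℂ] H.tensor (K.tensor L)) →⋆ₐ[ℂ]
      ((H.tensor K).tensor L →L[ℂ] (H.tensor K).tensor L) :=
  StarAlgHomClass.toStarAlgHom (Hilb.assoc H K L).symm.conjStarAlgEquiv

theorem Hilb.reassoc_op {H K L : Hilb.{u}} (R : H →L[ℂ] H) (S : K →L[ℂ] K) (T : L →L[ℂ] L) :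
    Hilb.reassoc H K L (Hilb.op R (Hilb.op S T)) = Hilb.op (Hilb.op R S) T := by
  refine Hilb.ext_tmul_tmul fun x y z => ?_
  change (Hilb.assoc H K L).symm (Hilb.op R (Hilb.op S T) (Hilb.assoc H K L _)) = _
  rw [LinearIsometryEquiv.symm_apply_eq, Hilb.assoc_tmul, Hilb.op_tmul, Hilb.op_tmul, Hilb.op_tmul,
    Hilb.op_tmul, Hilb.assoc_tmul]

theorem Hilb.reassoc_left {H K L : Hilb.{u}} (R : H →L[ℂ] H) :
    Hilb.reassoc H K L (Hilb.left H (K.tensor L) R) =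
      Hilb.left (H.tensor K) L (Hilb.left H K R) := by
  have h := Hilb.reassoc_op R (1 : K →L[ℂ] K) (1 : L →L[ℂ] L)
  rwa [show Hilb.op (1 : K →L[ℂ] K) (1 : L →L[ℂ] L) = 1 from opTensor_one] at h

section MinTensor

variable {A B C D E : Type u} [CStarAlgebra A] [CStarAlgebra B] [CStarAlgebra C] [CStarAlgebra D]
  [CStarAlgebra E]

/-- The elementary tensor `a ⊗ b`. -/
def tmul (a : A) (b : B) : MinTensor A B :=
  ⟨amb2Left a * amb2Right b,
    StarSubalgebra.le_topologicalClosure _ (StarAlgebra.subset_adjoin _ _ ⟨a, b, rfl⟩)⟩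

/-- The elementary tensor `a ⊗ b ⊗ c`. -/
def tmul3 (a : A) (b : B) (c : C) : MinTensor3 A B C :=
  ⟨amb3One a * amb3Two b * amb3Three c,
    StarSubalgebra.le_topologicalClosure _ (StarAlgebra.subset_adjoin _ _ ⟨a, b, c, rfl⟩)⟩

/-- The representation `π ⊗ σ` of `A ⊗ B`. -/
def evalAt (p : Rep A) (q : Rep B) : MinTensor A B →⋆ₐ[ℂ] (p.H.tensor q.H →L[ℂ] p.H.tensor q.H) :=
  (Fam.eval (H := fun p : Rep A × Rep B => p.1.H.tensor p.2.H) (p, q)).comp (minTensor A B).subtype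

theorem evalAt_tmul (p : Rep A) (q : Rep B) (a : A) (b : B) :
    evalAt p q (tmul a b) = Hilb.op (p.π a) (q.π b) :=
  Hilb.left_mul_right _ _

/-- A closed `*`-subalgebra of `A ⊗ B` that contains all elementary tensors is everything. -/
theorem mem_of_tmul_mem (S : StarSubalgebra ℂ (MinTensor A B))
    (hS : IsClosed (S : Set (MinTensor A B))) (h : ∀ a b, tmul a b ∈ S) (t : MinTensor A B) :
    t ∈ S := by
  have hle : minTensor A B ≤ S.map (minTensor A B).subtype := by
    refine StarSubalgebra.topologicalClosure_minimal (StarAlgebra.adjoin_le ?_) ?_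
    · rintro _ ⟨a, b, rfl⟩
      exact ⟨tmul a b, h a b, rfl⟩
    · exact (isClosed_minTensor A B).isClosedEmbedding_subtypeVal.isClosedMap _ hS
  obtain ⟨t', ht', h⟩ := hle t.2
  rwa [← Subtype.ext h]

/-- A `*`-homomorphism on `A ⊗ B` with values in the families that define `C ⊗ D ⊗ E` takes values
in `C ⊗ D ⊗ E` if it does so on elementary tensors. -/
theorem mem_minTensor3 (f : MinTensor A B →⋆ₐ[ℂ] Amb3 C D E)
    (h : ∀ a b, f (tmul a b) ∈ minTensor3 C D E) (t : MinTensor A B) : f t ∈ minTensor3 C D E := by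
  have hf : Continuous f :=
    AddMonoidHomClass.continuous_of_bound f 1 fun x => by
      rw [one_mul]; exact NonUnitalStarAlgHom.norm_apply_le f x
  exact mem_of_tmul_mem ((minTensor3 C D E).comap f) ((isClosed_minTensor3 C D E).preimage hf) h t

theorem tmul3_one_one (a : A) : amb3One a ∈ minTensor3 A B C := by
  have := (tmul3 a (1 : B) (1 : C)).2
  simpa [tmul3] using this

theorem one_tmul3_one (b : B) : amb3Two b ∈ minTensor3 A B C := by
  have := (tmul3 (1 : A) b (1 : C)).2
  simpa [tmul3] using this

theorem one_one_tmul3 (c : C) : amb3Three c ∈ minTensor3 A B C := by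
  have := (tmul3 (1 : A) (1 : B) c).2
  simpa [tmul3] using this

/-- `t ↦ t ⊗ 1` -/
def leg12 : MinTensor A B →⋆ₐ[ℂ] Amb3 A B C := Fam.lift fun p =>
  (Hilb.left (p.1.H.tensor p.2.1.H) p.2.2.H).comp (evalAt p.1 p.2.1)

/-- `t ↦ 1 ⊗ t` -/
def leg23 : MinTensor B C →⋆ₐ[ℂ] Amb3 A B C := Fam.lift fun p =>
  ((Hilb.reassoc p.1.H p.2.1.H p.2.2.H).comp
    (Hilb.right p.1.H (p.2.1.H.tensor p.2.2.H))).comp (evalAt p.2.1 p.2.2)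

theorem leg12_mem (t : MinTensor A B) : (leg12 t : Amb3 A B C) ∈ minTensor3 A B C := by
  refine mem_minTensor3 _ (fun a b => ?_) t
  have : (leg12 (tmul a b) : Amb3 A B C) = amb3One a * amb3Two b :=
    Fam.ext fun p => map_mul (Hilb.left (p.1.H.tensor p.2.1.H) p.2.2.H) _ _
  rw [this]
  exact mul_mem (tmul3_one_one a) (one_tmul3_one b)

/-- The pullback of `π ⊗ σ` along a homomorphism `A → B ⊗ C`, as a representation of `A`. -/
def Rep.pull (φ : A →⋆ₐ[ℂ] MinTensor B C) (p : Rep B) (q : Rep C) : Rep A :=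
  ⟨p.H.tensor q.H, (evalAt p q).comp φ⟩

/-- `φ ⊗ id`, on bounded families: `((φ ⊗ id)(t))_{π, σ, τ} = t_{(π ⊗ σ) ∘ φ, τ}`. -/
def ambMapLeft (φ : A →⋆ₐ[ℂ] MinTensor B C) : MinTensor A D →⋆ₐ[ℂ] Amb3 B C D :=
  Fam.lift fun p => evalAt (Rep.pull φ p.1 p.2.1) p.2.2

/-- `id ⊗ φ`, on bounded families: `((id ⊗ φ)(t))_{π, σ, τ} = t_{π, (σ ⊗ τ) ∘ φ}`, as an operator on
`(H ⊗ K) ⊗ L` through the associativity unitary. -/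
def ambMapRight (φ : D →⋆ₐ[ℂ] MinTensor B C) : MinTensor A D →⋆ₐ[ℂ] Amb3 A B C :=
  Fam.lift fun p =>
    (Hilb.reassoc p.1.H p.2.1.H p.2.2.H).comp (evalAt p.1 (Rep.pull φ p.2.1 p.2.2))

theorem ambMapLeft_tmul (φ : A →⋆ₐ[ℂ] MinTensor B C) (a : A) (d : D) :
    ambMapLeft φ (tmul a d) = leg12 (φ a) * amb3Three d :=
  Fam.ext fun p =>
    (evalAt_tmul (Rep.pull φ p.1 p.2.1) p.2.2 a d).trans (Hilb.left_mul_right _ _).symm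

theorem ambMapRight_tmul (φ : D →⋆ₐ[ℂ] MinTensor B C) (a : A) (d : D) :
    ambMapRight φ (tmul a d) = amb3One a * leg23 (φ d) := by
  refine Fam.ext fun p => ?_
  refine (congrArg (Hilb.reassoc p.1.H p.2.1.H p.2.2.H)
    (evalAt_tmul p.1 (Rep.pull φ p.2.1 p.2.2) a d)).trans ?_
  rw [← Hilb.left_mul_right]
  refine (map_mul (Hilb.reassoc p.1.H p.2.1.H p.2.2.H) _ _).trans ?_
  exact congrArg₂ (· * ·) (Hilb.reassoc_left (p.1.π a)) rfl

theorem leg23_mem (t : MinTensor B C) : (leg23 t : Amb3 A B C) ∈ minTensor3 A B C := by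
  refine mem_minTensor3 _ (fun b c => ?_) t
  have : (leg23 (tmul b c) : Amb3 A B C) = amb3Two b * amb3Three c := by
    refine Fam.ext fun p => ?_
    refine (congrArg (fun T => Hilb.reassoc p.1.H p.2.1.H p.2.2.H
      (Hilb.right p.1.H (p.2.1.H.tensor p.2.2.H) T)) (evalAt_tmul p.2.1 p.2.2 b c)).trans ?_
    exact (Hilb.reassoc_op 1 (p.2.1.π b) (p.2.2.π c)).trans (Hilb.left_mul_right _ _).symm
  rw [this]
  exact mul_mem (one_tmul3_one b) (one_one_tmul3 c)

/-- The homomorphism `φ ⊗ id : A ⊗ D → B ⊗ C ⊗ D`. -/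
def mapLeft (D : Type u) [CStarAlgebra D] (φ : A →⋆ₐ[ℂ] MinTensor B C) :
    MinTensor A D →⋆ₐ[ℂ] MinTensor3 B C D :=
  (ambMapLeft φ).codRestrict (minTensor3 B C D) <| mem_minTensor3 _ fun a d => by
    rw [ambMapLeft_tmul]
    exact mul_mem (leg12_mem _) (one_one_tmul3 d)

/-- The homomorphism `id ⊗ φ : A ⊗ D → A ⊗ B ⊗ C`. -/
def mapRight (A : Type u) [CStarAlgebra A] (φ : D →⋆ₐ[ℂ] MinTensor B C) :
    MinTensor A D →⋆ₐ[ℂ] MinTensor3 A B C :=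
  (ambMapRight φ).codRestrict (minTensor3 A B C) <| mem_minTensor3 _ fun a d => by
    rw [ambMapRight_tmul]
    exact mul_mem (tmul3_one_one a) (leg23_mem _)

end MinTensor

/-! ### Compact quantum groups and their actions -/

/-- A `C*` quantum group: a unital `C*`-algebra `A` with a coassociative unital
`*`-homomorphism `Δ : A → A ⊗ A` such that `(A ⊗ 1)Δ(A)` and `(1 ⊗ A)Δ(A)` span dense subspaces of
`A ⊗ A`. -/
structure QuantumGroup (A : Type u) [CStarAlgebra A] where
  /-- the comultiplication -/
  Δ : A →⋆ₐ[ℂ] MinTensor A A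
  coassoc : ∀ a, mapLeft A Δ (Δ a) = mapRight A Δ (Δ a)
  dense_left : Dense (Submodule.span ℂ {t : MinTensor A A | ∃ a b, t = tmul a 1 * Δ b} :
    Set (MinTensor A A))
  dense_right : Dense (Submodule.span ℂ {t : MinTensor A A | ∃ a b, t = tmul 1 a * Δ b} :
    Set (MinTensor A A))

/-- A right coaction of a `C*` quantum group on a unital `C*`-algebra `B`. -/
structure Coaction {A : Type u} [CStarAlgebra A] (G : QuantumGroup A) (B : Type u)
    [CStarAlgebra B] where
  /-- the structure map -/
  ρ : B →⋆ₐ[ℂ] MinTensor B A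
  coassoc : ∀ b, mapLeft A ρ (ρ b) = mapRight B G.Δ (ρ b)
  dense : Dense (Submodule.span ℂ {t : MinTensor B A | ∃ a b, t = tmul 1 a * ρ b} :
    Set (MinTensor B A))

/-- An action of a quantum group on a compact space `X`: a coaction on `C(X)`. -/
abbrev Action {A : Type u} [CStarAlgebra A] (G : QuantumGroup A) (X : Type u) [TopologicalSpace X]
    [CompactSpace X] := Coaction G C(X, ℂ)

/-! ### States -/

/-- A state: a positive unital continuous functional. -/
structure State (A : Type*) [CStarAlgebra A] where
  /-- the functional -/
  toFun : A →L[ℂ] ℂ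
  nonneg : ∀ a, 0 ≤ toFun (star a * a)
  map_one : toFun 1 = 1

section State

variable {A B : Type u} [CStarAlgebra A] [CStarAlgebra B]

theorem State.exists_gns (φ : State A) :
    ∃ (p : Rep A) (ξ : p.H), ∀ a, inner ℂ ξ (p.π a ξ) = φ.toFun a := by
  let _ := CStarAlgebra.spectralOrder A
  have _ := CStarAlgebra.spectralOrderedRing A
  let f : A →ₚ[ℂ] ℂ := PositiveLinearMap.mk₀ φ.toFun.toLinearMap fun x hx => by
    obtain ⟨y, rfl⟩ := CStarAlgebra.nonneg_iff_eq_star_mul_self.mp hx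
    exact φ.nonneg y
  have key : ∀ a, inner ℂ ((f.toPreGNS 1 : f.PreGNS) : f.GNS)
      (f.gnsStarAlgHom a ((f.toPreGNS 1 : f.PreGNS) : f.GNS)) = φ.toFun a := fun a => by
    refine (congrArg (inner ℂ ((f.toPreGNS 1 : f.PreGNS) : f.GNS))
      (f.gnsNonUnitalStarAlgHom_apply_coe (a := a) (b := f.toPreGNS 1))).trans ?_
    rw [Completion.inner_coe, PositiveLinearMap.preGNS_inner_def]
    simp only [PositiveLinearMap.ofPreGNS_toPreGNS, PositiveLinearMap.leftMulMapPreGNS_apply,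
      star_one, one_mul, mul_one]
    rfl
  have : Nontrivial f.GNS := by
    refine ⟨((f.toPreGNS 1 : f.PreGNS) : f.GNS), 0, fun h => ?_⟩
    have := key 1
    rw [h, inner_zero_left, φ.map_one] at this
    exact zero_ne_one this
  exact ⟨⟨⟨f.GNS⟩, f.gnsStarAlgHom⟩, ((f.toPreGNS 1 : f.PreGNS) : f.GNS), key⟩

/-- A representation (the GNS representation) on which the state `φ` is a vector state. -/
def State.rep (φ : State A) : Rep A := φ.exists_gns.choose

/-- A vector with vector state `φ`. -/
def State.vec (φ : State A) : φ.rep.H := φ.exists_gns.choose_spec.choose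

theorem State.inner_vec (φ : State A) (a : A) :
    inner ℂ φ.vec (φ.rep.π a φ.vec) = φ.toFun a := φ.exists_gns.choose_spec.choose_spec a

/-- The product state `φ ⊗ ψ` on `A ⊗ B`, as a vector state. By continuity it is determined by
`(φ ⊗ ψ)(a ⊗ b) = φ(a) ψ(b)`. -/
def State.prod (φ : State A) (ψ : State B) : State (MinTensor A B) where
  toFun := LinearMap.mkContinuous
    { toFun := fun t => inner ℂ (Hilb.tmul φ.vec ψ.vec)
        (evalAt φ.rep ψ.rep t (Hilb.tmul φ.vec ψ.vec))
      map_add' := fun s t => by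
        rw [_root_.map_add, _root_.add_apply, inner_add_right]
      map_smul' := fun c t => by
        rw [_root_.map_smul, _root_.smul_apply, inner_smul_right]; rfl }
    (‖Hilb.tmul φ.vec ψ.vec‖ * ‖Hilb.tmul φ.vec ψ.vec‖) fun t => by
      refine (norm_inner_le_norm (𝕜 := ℂ) (Hilb.tmul φ.vec ψ.vec)
        (evalAt φ.rep ψ.rep t (Hilb.tmul φ.vec ψ.vec))).trans ?_
      rw [mul_assoc]
      refine mul_le_mul_of_nonneg_left ?_ (norm_nonneg _)
      rw [mul_comm]
      exact ContinuousLinearMap.le_of_opNorm_le _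
        (NonUnitalStarAlgHom.norm_apply_le (evalAt φ.rep ψ.rep) t) _
  nonneg t := by
    change 0 ≤ inner ℂ (Hilb.tmul φ.vec ψ.vec)
        (evalAt φ.rep ψ.rep (star t * t) (Hilb.tmul φ.vec ψ.vec))
    rw [_root_.map_mul, map_star, mul_apply_eq_comp, ContinuousLinearMap.star_eq_adjoint,
      ContinuousLinearMap.adjoint_inner_right]
    rw [inner_self_eq_norm_sq_to_K, ← RCLike.ofReal_pow]
    exact Complex.zero_le_real.mpr (sq_nonneg _)
  map_one := by
    change inner ℂ (Hilb.tmul φ.vec ψ.vec) (evalAt φ.rep ψ.rep 1 (Hilb.tmul φ.vec ψ.vec)) = 1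
    have h1 := φ.inner_vec 1
    have h2 := ψ.inner_vec 1
    rw [_root_.map_one, one_apply_eq_self, State.map_one] at h1 h2
    rw [_root_.map_one, one_apply_eq_self, Hilb.inner_tmul, h1, h2, one_mul]

theorem State.prod_tmul (φ : State A) (ψ : State B) (a : A) (b : B) :
    (φ.prod ψ).toFun (tmul a b) = φ.toFun a * ψ.toFun b := by
  change inner ℂ (Hilb.tmul φ.vec ψ.vec)
    (evalAt φ.rep ψ.rep (tmul a b) (Hilb.tmul φ.vec ψ.vec)) = _
  rw [evalAt_tmul, Hilb.op_tmul, Hilb.inner_tmul, State.inner_vec, State.inner_vec]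

theorem continuous_starAlgHom {A B : Type*} [CStarAlgebra A] [CStarAlgebra B] (f : A →⋆ₐ[ℂ] B) :
    Continuous f :=
  AddMonoidHomClass.continuous_of_bound f 1 fun x => by
    rw [one_mul]; exact NonUnitalStarAlgHom.norm_apply_le f x

/-- The pullback of a state along a unital `*`-homomorphism. -/
def State.comp {A B : Type*} [CStarAlgebra A] [CStarAlgebra B] (φ : State B) (f : A →⋆ₐ[ℂ] B) :
    State A where
  toFun := φ.toFun.comp ⟨f.toLinearMap, continuous_starAlgHom f⟩
  nonneg a := by
    change 0 ≤ φ.toFun (f (star a * a))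
    rw [map_mul, map_star]
    exact φ.nonneg (f a)
  map_one := by
    change φ.toFun (f 1) = 1
    rw [_root_.map_one, φ.map_one]

theorem State.comp_apply {A B : Type*} [CStarAlgebra A] [CStarAlgebra B] (φ : State B) (f : A →⋆ₐ[ℂ] B) (a : A) :
    (φ.comp f).toFun a = φ.toFun (f a) := rfl

end State

section Measure

variable {X : Type u} [MetricSpace X] [CompactSpace X] [MeasurableSpace X] [BorelSpace X]

/-- Integration against a probability measure, as a state on `C(X)`. -/
def State.ofMeasure (μ : ProbabilityMeasure X) : State C(X, ℂ) where
  toFun := LinearMap.mkContinuous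
    { toFun := fun f => ∫ x, f x ∂(μ : Measure X)
      map_add' := fun f g => integral_add
        (f.continuous.integrable_of_hasCompactSupport (HasCompactSupport.of_compactSpace f))
        (g.continuous.integrable_of_hasCompactSupport (HasCompactSupport.of_compactSpace g))
      map_smul' := fun c f => integral_smul c _ } 1 fun f => by
        refine (norm_integral_le_of_norm_le_const (C := ‖f‖)
          (Filter.Eventually.of_forall f.norm_coe_le_norm)).trans ?_
        simp
  nonneg f := by
    change 0 ≤ ∫ x, star (f x) * f x ∂(μ : Measure X)
    have h : ∀ x, star (f x) * f x = ((‖f x‖ ^ 2 : ℝ) : ℂ) := fun x => by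
      rw [Complex.star_def, Complex.conj_mul']; norm_cast
    simp_rw [h]
    rw [integral_complex_ofReal]
    exact_mod_cast integral_nonneg fun x => by positivity
  map_one := by
    change ∫ _, (1 : ℂ) ∂(μ : Measure X) = 1
    simp

theorem State.exists_measure (φ : State C(X, ℂ)) :
    ∃ μ : ProbabilityMeasure X, ∀ f : C(X, ℂ), ∫ x, f x ∂(μ : Measure X) = φ.toFun f := by
  let c : C(X, ℝ) → C(X, ℂ) := fun f => ⟨fun x => (f x : ℂ), by fun_prop⟩
  have hsq : ∀ f : C(X, ℝ), (∀ x, 0 ≤ f x) → 0 ≤ φ.toFun (c f) := fun f hf => by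
    have : c f = star (c ⟨fun x => √(f x), by fun_prop⟩) * c ⟨fun x => √(f x), by fun_prop⟩ := by
      ext x
      simp only [c, ContinuousMap.coe_mk, ContinuousMap.mul_apply, ContinuousMap.star_apply,
        Complex.star_def, Complex.conj_ofReal]
      rw [← Complex.ofReal_mul, Real.mul_self_sqrt (hf x)]
    rw [this]
    exact φ.nonneg _
  have hadd : ∀ f g, c (f + g) = c f + c g := fun f g => by ext x; simp [c]
  have hsmul : ∀ (r : ℝ) f, c (r • f) = (r : ℂ) • c f := fun r f => by ext x; simp [c]
  have him : ∀ f, (φ.toFun (c f)).im = 0 := fun f => by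
    have h1 := hsq (f + ContinuousMap.const X ‖f‖) fun x => by
      have := f.norm_coe_le_norm x
      rw [Real.norm_eq_abs] at this
      simpa using (by linarith [neg_abs_le (f x)] : 0 ≤ f x + ‖f‖)
    have h2 := hsq (ContinuousMap.const X ‖f‖) fun x => norm_nonneg f
    rw [hadd, map_add, Complex.nonneg_iff, Complex.add_im] at h1
    rw [Complex.nonneg_iff] at h2
    linarith [h1.2, h2.2]
  let Λ : C_c(X, ℝ) →ₚ[ℝ] ℝ := PositiveLinearMap.mk₀
    { toFun := fun f => (φ.toFun (c f.toContinuousMap)).re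
      map_add' := fun f g => by
        rw [← Complex.add_re, ← map_add, ← hadd]; rfl
      map_smul' := fun r f => by
        have : c (r • f : C_c(X, ℝ)).toContinuousMap = (r : ℂ) • c f.toContinuousMap := hsmul r _
        rw [this, map_smul]
        simp }
    fun f hf => (Complex.nonneg_iff.mp (hsq f.toContinuousMap hf)).1
  have hΛ : ∀ f : C(X, ℝ), ((∫ x, f x ∂(RealRMK.rieszMeasure Λ) : ℝ) : ℂ) = φ.toFun (c f) :=
    fun f => by
      have h := RealRMK.integral_rieszMeasure Λ ⟨f, HasCompactSupport.of_compactSpace f⟩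
      refine Complex.ext ?_ ?_
      · exact h
      · rw [him f, Complex.ofReal_im]
  have hprob : IsProbabilityMeasure (RealRMK.rieszMeasure Λ) := by
    have h := hΛ 1
    have h1 : c 1 = 1 := by ext x; simp [c]
    rw [h1, φ.map_one] at h
    simp only [ContinuousMap.one_apply, integral_const, smul_eq_mul, mul_one] at h
    exact isProbabilityMeasure_iff_real.mpr (by exact_mod_cast h)
  refine ⟨⟨RealRMK.rieszMeasure Λ, hprob⟩, fun f => ?_⟩
  have hf : f = c ⟨fun x => (f x).re, by fun_prop⟩ +
      Complex.I • c ⟨fun x => (f x).im, by fun_prop⟩ := by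
    ext x
    simp [c, mul_comm Complex.I, Complex.re_add_im]
  have hint : Integrable f (RealRMK.rieszMeasure Λ) :=
    f.continuous.integrable_of_hasCompactSupport (HasCompactSupport.of_compactSpace f)
  conv_rhs => rw [hf, map_add, map_smul, ← hΛ, ← hΛ]
  refine (integral_re_add_im hint).symm.trans ?_
  simp [mul_comm]

/-- The probability measure that represents a state on `C(X)`. -/
def State.toMeasure (φ : State C(X, ℂ)) : ProbabilityMeasure X := φ.exists_measure.choose

theorem State.integral_toMeasure (φ : State C(X, ℂ)) (f : C(X, ℂ)) :
    ∫ x, f x ∂(φ.toMeasure : Measure X) = φ.toFun f := φ.exists_measure.choose_spec f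

variable {A : Type u} [CStarAlgebra A] {G : QuantumGroup A}

/-- The probability measure `μ ◁ ψ`, which corresponds to the state `(μ ⊗ ψ) ∘ ρ` on `C(X)`. -/
def Action.act (α : Action G X) (μ : ProbabilityMeasure X) (ψ : State A) : ProbabilityMeasure X :=
  (((State.ofMeasure μ).prod ψ).comp α.ρ).toMeasure

theorem Action.integral_act (α : Action G X) (μ : ProbabilityMeasure X) (ψ : State A)
    (f : C(X, ℂ)) :
    ∫ x, f x ∂(α.act μ ψ : Measure X) = ((State.ofMeasure μ).prod ψ).toFun (α.ρ f) :=
  State.integral_toMeasure _ f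

end Measure

section Wasserstein

variable {X : Type*} [MetricSpace X] [CompactSpace X] [MeasurableSpace X] [BorelSpace X]

/-- The couplings of `μ` and `ν`: the probability measures on `X × X` with marginals `μ`, `ν`. -/
def couplings (μ ν : ProbabilityMeasure X) : Set (ProbabilityMeasure (X × X)) :=
  {π | (π : Measure (X × X)).map Prod.fst = μ ∧ (π : Measure (X × X)).map Prod.snd = ν}

/-- The Wasserstein `p`-distance. -/
def wasserstein (p : ℝ) (μ ν : ProbabilityMeasure X) : ℝ :=
  ⨅ π : couplings μ ν, (∫ z, dist z.1 z.2 ^ p ∂(π.1 : Measure (X × X))) ^ (1 / p)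

end Wasserstein

/-- Condition (Lip_p): every state of `A` contracts the Wasserstein `p`-distance on the probability
measures on `X`. -/
def Action.Lip {X : Type u} [MetricSpace X] [CompactSpace X] [MeasurableSpace X] [BorelSpace X]
    {A : Type u} [CStarAlgebra A] {G : QuantumGroup A} (α : Action G X) (p : ℝ) : Prop :=
  ∀ (μ ν : ProbabilityMeasure X) (ψ : State A),
    wasserstein p (α.act μ ψ) (α.act ν ψ) ≤ wasserstein p μ ν

end CQG

end

/-! For the forward direction, restrict to Dirac measures: the point mass at `(x, y)` couples `δ_x`
with `δ_y`, so their Wasserstein distance is at most `d(x, y)`.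

For the converse, fix `ψ` and put `P x = x ◁ ψ`. Two facts about the action enter. The map `P` is
weakly continuous (`Action.continuous_act_diracProba`), and `μ ◁ ψ` is the barycenter `∫ P x dμ(x)`
(`Action.integral_act_eq_integral_integral`). Both express that slicing by `ψ` turns an element of
`C(X) ⊗ A` into a continuous function on `X`. This is evident for `f ⊗ a`, and it passes to all
elements because spans of elementary tensors are dense (`dense_span_tmul`) and product states are
contractive (`State.norm_prod_apply_le`).

The rest is optimal transport (`exists_coupling_barycenter`). Given a coupling `π` of `μ` and `ν`,
average nearly optimal couplings of `P x` and `P y` over `π`. The result couples the two barycenters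
at a cost of at most about `∫ d(x, y)^p dπ`. To make the average meaningful without choosing
couplings measurably, `(x, y)` is first rounded to finitely many points; the rounding error and the
slack in optimality both vanish in a weak limit, which exists because `X × X` is compact. The
infimum over `π` gives the claim. -/

namespace CQG

/-! ### Transport costs, couplings and their marginals. -/

section Wasserstein

open Filter Topology ProbabilityTheory BoundedContinuousFunction

variable {X : Type*} [MetricSpace X] [MeasurableSpace X]

/-- The transport cost `d(x, y)^p`, as a bounded continuous function. -/
noncomputable def cost (X : Type*) [MetricSpace X] [CompactSpace X] {p : ℝ} (hp : 0 ≤ p) :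
    (X × X) →ᵇ ℝ :=
  BoundedContinuousFunction.mkOfCompact
    ⟨fun z => dist z.1 z.2 ^ p, continuous_dist.rpow_const fun _ => Or.inr hp⟩

theorem integral_cost_nonneg (p : ℝ) (π : Measure (X × X)) :
    0 ≤ ∫ z, dist z.1 z.2 ^ p ∂π :=
  integral_nonneg fun _ => Real.rpow_nonneg dist_nonneg _

theorem wasserstein_le_of_mem_couplings {p : ℝ} {μ ν : ProbabilityMeasure X}
    {π : ProbabilityMeasure (X × X)} (hπ : π ∈ couplings μ ν) :
    wasserstein p μ ν ≤ (∫ z, dist z.1 z.2 ^ p ∂(π : Measure (X × X))) ^ (1 / p) :=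
  ciInf_le ⟨0, by
    rintro _ ⟨π, rfl⟩
    exact Real.rpow_nonneg (integral_cost_nonneg p _) _⟩ (⟨π, hπ⟩ : couplings μ ν)

variable [BorelSpace X]

theorem integral_fst_of_mem_couplings {μ ν : ProbabilityMeasure X}
    {π : ProbabilityMeasure (X × X)} (hπ : π ∈ couplings μ ν) {f : X → ℝ} (hf : Continuous f) :
    ∫ z, f z.1 ∂(π : Measure (X × X)) = ∫ x, f x ∂(μ : Measure X) := by
  rw [← hπ.1, integral_map measurable_fst.aemeasurable hf.aestronglyMeasurable]

theorem integral_snd_of_mem_couplings {μ ν : ProbabilityMeasure X}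
    {π : ProbabilityMeasure (X × X)} (hπ : π ∈ couplings μ ν) {f : X → ℝ} (hf : Continuous f) :
    ∫ z, f z.2 ∂(π : Measure (X × X)) = ∫ x, f x ∂(ν : Measure X) := by
  rw [← hπ.2, integral_map measurable_snd.aemeasurable hf.aestronglyMeasurable]

/-- Finite Borel measures on a metric space are determined by their integrals of bounded continuous
functions. This recovers the marginals of a weak limit, about which only such integrals are known.
-/
theorem map_eq_of_forall_integral_eq {Y : Type*} [MeasurableSpace Y] {g : Y → X}
    (hg : Measurable g) {μ : ProbabilityMeasure X} {π : ProbabilityMeasure Y}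
    (h : ∀ f : X →ᵇ ℝ, ∫ z, f (g z) ∂(π : Measure Y) = ∫ x, f x ∂(μ : Measure X)) :
    (π : Measure Y).map g = μ := by
  have := Measure.isProbabilityMeasure_map (μ := (π : Measure Y)) hg.aemeasurable
  refine ext_of_forall_integral_eq_of_IsFiniteMeasure fun f => ?_
  rw [integral_map hg.aemeasurable f.continuous.aestronglyMeasurable, h]

variable [CompactSpace X]

/-- The product measure is a coupling. Without one, the real infimum in `wasserstein` would take the
default value `0` and carry no information. -/
instance nonempty_couplings (μ ν : ProbabilityMeasure X) : Nonempty (couplings μ ν) :=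
  ⟨⟨μ.prod ν, by simp [couplings, Measure.map_fst_prod, Measure.map_snd_prod]⟩⟩

/-- The slack `ε` takes the place of an optimal coupling: a real number strictly above an infimum is
beaten by some member, and raising to the power `p` removes the root. -/
theorem exists_coupling_integral_le {p r ε : ℝ} (hp : 0 < p) {μ ν : ProbabilityMeasure X}
    (h : wasserstein p μ ν ≤ r) (hε : 0 < ε) :
    ∃ π ∈ couplings μ ν, ∫ z, dist z.1 z.2 ^ p ∂(π : Measure (X × X)) ≤ (r + ε) ^ p := by
  obtain ⟨⟨π, hπ⟩, h⟩ := exists_lt_of_ciInf_lt (lt_of_le_of_lt h (lt_add_of_pos_right r hε))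
  refine ⟨π, hπ, ?_⟩
  have h0 := integral_cost_nonneg p (π : Measure (X × X))
  calc _ = ((∫ z, dist z.1 z.2 ^ p ∂(π : Measure (X × X))) ^ (1 / p)) ^ p := by
        rw [← Real.rpow_mul h0, one_div_mul_cancel hp.ne', Real.rpow_one]
    _ ≤ _ := Real.rpow_le_rpow (Real.rpow_nonneg h0 _) h.le hp.le

/-- The coupling used is the point mass at `(x, y)`. The upper bound alone suffices to pass from
measures to points. -/
theorem wasserstein_diracProba_le {p : ℝ} (hp : 0 < p) (x y : X) :
    wasserstein p (diracProba x) (diracProba y) ≤ dist x y := by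
  have hmem : diracProba (x, y) ∈ couplings (diracProba x) (diracProba y) := by
    constructor
    · exact Measure.map_dirac' measurable_fst _
    · exact Measure.map_dirac' measurable_snd _
  refine (wasserstein_le_of_mem_couplings hmem).trans_eq ?_
  have : ∫ z, dist z.1 z.2 ^ p ∂(diracProba (x, y) : Measure (X × X)) = dist x y ^ p :=
    integral_dirac _ _
  rw [this, ← Real.rpow_mul dist_nonneg, mul_one_div_cancel hp.ne', Real.rpow_one]

/-! ### Gluing couplings of a family of measures. -/

/-- Couplings of `P x` and `P y` can be glued along a coupling of `μ` and `ν` to a coupling of the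
barycenters. Instead of a measurable selection, the proof uses a weak limit of the couplings that
arise from finitely many `x` and `y`. -/
theorem exists_coupling_barycenter {p : ℝ} (hp : 0 < p) {P : X → ProbabilityMeasure X}
    (hP : Continuous P) (hW : ∀ x y, wasserstein p (P x) (P y) ≤ dist x y)
    {μ ν μ' ν' : ProbabilityMeasure X}
    (hμ : ∀ f : X →ᵇ ℝ, ∫ x, f x ∂(μ' : Measure X) =
      ∫ x, ∫ y, f y ∂(P x : Measure X) ∂(μ : Measure X))
    (hν : ∀ f : X →ᵇ ℝ, ∫ x, f x ∂(ν' : Measure X) =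
      ∫ x, ∫ y, f y ∂(P x : Measure X) ∂(ν : Measure X))
    {π : ProbabilityMeasure (X × X)} (hπ : π ∈ couplings μ ν) :
    ∃ Γ ∈ couplings μ' ν', ∫ z, dist z.1 z.2 ^ p ∂(Γ : Measure (X × X)) ≤
      ∫ z, dist z.1 z.2 ^ p ∂(π : Measure (X × X)) := by
  obtain ⟨x₀⟩ := μ.nonempty
  -- Finite-valued approximations of the identity of `X`, which round every point.
  let s : ℕ → SimpleFunc X X :=
    SimpleFunc.approxOn id measurable_id Set.univ x₀ (Set.mem_univ _)
  have hs : ∀ x, Tendsto (fun n => s n x) atTop (𝓝 x) := fun x =>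
    SimpleFunc.tendsto_approxOn measurable_id (Set.mem_univ _) (by simp)
  -- Couplings with slack `1 / (n + 1)`, chosen for each pair with no measurability in `z`.
  choose γ hγ hγ' using fun (n : ℕ) (z : X × X) =>
    exists_coupling_integral_le hp (hW z.1 z.2) (Nat.one_div_pos_of_nat (α := ℝ) (n := n))
  let S : ℕ → SimpleFunc (X × X) (X × X) := fun n =>
    ((s n).comp Prod.fst measurable_fst).pair ((s n).comp Prod.snd measurable_snd)
  have hS : ∀ z, Tendsto (fun n => S n z) atTop (𝓝 z) := fun z =>
    (hs z.1).prodMk_nhds (hs z.2)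
  -- Precomposing the arbitrary choice `γ n` with the simple function `S n` leaves finitely many
  -- values on measurable pieces, hence a measurable kernel.
  let κ : ℕ → Kernel (X × X) (X × X) := fun n =>
    ⟨fun z => (γ n (S n z) : Measure (X × X)),
      ((S n).map fun z => (γ n z : Measure (X × X))).measurable⟩
  have hκ : ∀ n, IsMarkovKernel (κ n) := fun n =>
    ⟨fun z => inferInstanceAs (IsProbabilityMeasure (γ n (S n z) : Measure (X × X)))⟩
  let Γ : ℕ → ProbabilityMeasure (X × X) := fun n =>
    ⟨(κ n ∘ₖ Kernel.const Unit (π : Measure (X × X))) (), inferInstance⟩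
  have hΓ : ∀ n (f : (X × X) →ᵇ ℝ), ∫ z, f z ∂(Γ n : Measure (X × X)) =
      ∫ z, ∫ w, f w ∂(γ n (S n z) : Measure (X × X)) ∂(π : Measure (X × X)) := fun n f =>
    Kernel.integral_comp (f.integrable ((κ n ∘ₖ Kernel.const Unit (π : Measure (X × X))) ()))
  -- The space of probability measures on `X × X` is compact, so `Γ` converges along any
  -- ultrafilter. One finer than `atTop` keeps all ordinary limits valid and spares a passage to
  -- subsequences.
  let U : Ultrafilter ℕ := Ultrafilter.of atTop
  have hU : (U : Filter ℕ) ≤ atTop := Ultrafilter.of_le atTop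
  obtain ⟨Γ₀, -, hΓ₀⟩ := isCompact_univ.ultrafilter_le_nhds (U.map Γ) (by simp)
  have hlim : ∀ f : (X × X) →ᵇ ℝ, Tendsto (fun n => ∫ z, f z ∂(Γ n : Measure (X × X))) U
      (𝓝 (∫ z, f z ∂(Γ₀ : Measure (X × X)))) :=
    ProbabilityMeasure.tendsto_iff_forall_integral_tendsto.mp hΓ₀
  have hPf : ∀ f : X →ᵇ ℝ, Continuous fun x => ∫ y, f y ∂(P x : Measure X) := fun f =>
    continuous_iff_continuousAt.mpr fun x =>
      ProbabilityMeasure.tendsto_iff_forall_integral_tendsto.mp (hP.tendsto x) f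
  have hbound : ∀ (f : X →ᵇ ℝ) x, ‖∫ y, f y ∂(P x : Measure X)‖ ≤ ‖f‖ := fun f x =>
    f.norm_integral_le_norm _
  -- Here `g` is arbitrary: its composite with `S n` is again a simple function.
  have hmeas : ∀ n (g : X × X → ℝ), AEStronglyMeasurable (fun z => g (S n z))
      (π : Measure (X × X)) := fun n g =>
    ((S n).map g).stronglyMeasurable.aestronglyMeasurable
  refine ⟨Γ₀, ⟨?_, ?_⟩, ?_⟩
  · refine map_eq_of_forall_integral_eq measurable_fst fun f => ?_
    have h1 : Tendsto (fun n => ∫ z, f z.1 ∂(Γ n : Measure (X × X))) U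
        (𝓝 (∫ z, f z.1 ∂(Γ₀ : Measure (X × X)))) :=
      hlim (f.compContinuous ⟨Prod.fst, continuous_fst⟩)
    have h2 : ∀ n, ∫ z, f z.1 ∂(Γ n : Measure (X × X)) =
        ∫ z, ∫ y, f y ∂(P (S n z).1 : Measure X) ∂(π : Measure (X × X)) := fun n =>
      (hΓ n (f.compContinuous ⟨Prod.fst, continuous_fst⟩)).trans
        (integral_congr_ae (.of_forall fun z =>
          integral_fst_of_mem_couplings (hγ n (S n z)) f.continuous))
    -- The same integrals converge to that of the limit `Γ₀` and, by weak continuity of `P` and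
    -- dominated convergence, to the barycenter integral.
    refine tendsto_nhds_unique h1 (Tendsto.mono_left ?_ hU)
    simp_rw [h2]
    rw [hμ f, ← integral_fst_of_mem_couplings hπ (hPf f)]
    exact tendsto_integral_of_dominated_convergence (fun _ => ‖f‖)
      (fun n => hmeas n fun z => ∫ y, f y ∂(P z.1 : Measure X)) (integrable_const _)
      (fun n => .of_forall fun z => hbound f _)
      (.of_forall fun z => (((hPf f).comp continuous_fst).tendsto z).comp (hS z))
  · refine map_eq_of_forall_integral_eq measurable_snd fun f => ?_
    have h1 : Tendsto (fun n => ∫ z, f z.2 ∂(Γ n : Measure (X × X))) U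
        (𝓝 (∫ z, f z.2 ∂(Γ₀ : Measure (X × X)))) :=
      hlim (f.compContinuous ⟨Prod.snd, continuous_snd⟩)
    have h2 : ∀ n, ∫ z, f z.2 ∂(Γ n : Measure (X × X)) =
        ∫ z, ∫ y, f y ∂(P (S n z).2 : Measure X) ∂(π : Measure (X × X)) := fun n =>
      (hΓ n (f.compContinuous ⟨Prod.snd, continuous_snd⟩)).trans
        (integral_congr_ae (.of_forall fun z =>
          integral_snd_of_mem_couplings (hγ n (S n z)) f.continuous))
    refine tendsto_nhds_unique h1 (Tendsto.mono_left ?_ hU)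
    simp_rw [h2]
    rw [hν f, ← integral_snd_of_mem_couplings hπ (hPf f)]
    exact tendsto_integral_of_dominated_convergence (fun _ => ‖f‖)
      (fun n => hmeas n fun z => ∫ y, f y ∂(P z.2 : Measure X)) (integrable_const _)
      (fun n => .of_forall fun z => hbound f _)
      (.of_forall fun z => (((hPf f).comp continuous_snd).tendsto z).comp (hS z))
  · have hdist : ∀ z : X × X, dist z.1 z.2 ≤ Metric.diam (Set.univ : Set X) := fun z =>
      Metric.dist_le_diam_of_mem isCompact_univ.isBounded (Set.mem_univ _) (Set.mem_univ _)
    -- The dominating constant: distances are at most the diameter, and the slack is at most `1`.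
    have hle : ∀ (n : ℕ) (z : X × X),
        ‖(dist (S n z).1 (S n z).2 + 1 / ((n : ℝ) + 1)) ^ p‖ ≤
          (Metric.diam (Set.univ : Set X) + 1) ^ p := fun n z => by
      have h0 : 0 ≤ 1 / ((n : ℝ) + 1) := Nat.one_div_pos_of_nat.le
      have h1 : 1 / ((n : ℝ) + 1) ≤ 1 := by
        rw [div_le_one (by positivity)]; linarith [n.cast_nonneg (α := ℝ)]
      rw [Real.norm_of_nonneg (by positivity)]
      exact Real.rpow_le_rpow (by positivity) (add_le_add (hdist _) h1) hp.le
    have hmeas' : ∀ n : ℕ, AEStronglyMeasurable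
        (fun z => (dist (S n z).1 (S n z).2 + 1 / ((n : ℝ) + 1)) ^ p) (π : Measure (X × X)) :=
      fun n => hmeas n fun z => (dist z.1 z.2 + 1 / ((n : ℝ) + 1)) ^ p
    have hup : Tendsto (fun n : ℕ => ∫ z, (dist (S n z).1 (S n z).2 + 1 / ((n : ℝ) + 1)) ^ p
        ∂(π : Measure (X × X))) atTop (𝓝 (∫ z, dist z.1 z.2 ^ p ∂(π : Measure (X × X)))) := by
      refine tendsto_integral_of_dominated_convergence
        (fun _ => (Metric.diam (Set.univ : Set X) + 1) ^ p) hmeas' (integrable_const _)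
        (fun n => .of_forall (hle n)) (.of_forall fun z => ?_)
      have h := ((continuous_dist.tendsto z).comp (hS z)).add
        (tendsto_one_div_add_atTop_nhds_zero_nat (𝕜 := ℝ))
      rw [add_zero] at h
      exact h.rpow_const (Or.inr hp.le)
    -- Compactness makes the cost a bounded continuous test function, so its integrals pass to the
    -- weak limit, and the bound for each `n` survives.
    refine le_of_tendsto_of_tendsto' (hlim (cost X hp.le)) (hup.mono_left hU) fun n => ?_
    rw [hΓ]
    exact integral_mono_of_nonneg
      (.of_forall fun z => integral_cost_nonneg p _)
      (Integrable.of_bound (hmeas' n) _ (.of_forall (hle n)))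
      (.of_forall fun z => hγ' n (S n z))

/-- If a weakly continuous family of probability measures contracts the Wasserstein distance on
Dirac measures, then its barycenters contract the Wasserstein distance. -/
theorem wasserstein_barycenter_le {p : ℝ} (hp : 0 < p) {P : X → ProbabilityMeasure X}
    (hP : Continuous P) (hW : ∀ x y, wasserstein p (P x) (P y) ≤ dist x y)
    {μ ν μ' ν' : ProbabilityMeasure X}
    (hμ : ∀ f : X →ᵇ ℝ, ∫ x, f x ∂(μ' : Measure X) =
      ∫ x, ∫ y, f y ∂(P x : Measure X) ∂(μ : Measure X))
    (hν : ∀ f : X →ᵇ ℝ, ∫ x, f x ∂(ν' : Measure X) =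
      ∫ x, ∫ y, f y ∂(P x : Measure X) ∂(ν : Measure X)) :
    wasserstein p μ' ν' ≤ wasserstein p μ ν := by
  refine le_ciInf fun ⟨π, hπ⟩ => ?_
  obtain ⟨Γ, hΓ, hle⟩ := exists_coupling_barycenter hp hP hW hμ hν hπ
  exact (wasserstein_le_of_mem_couplings hΓ).trans
    (Real.rpow_le_rpow (integral_cost_nonneg p _) hle (by positivity))

end Wasserstein

/-! ### Elementary tensors and their span. -/

section MinTensor

variable {A B : Type u} [CStarAlgebra A] [CStarAlgebra B]

theorem amb2Left_mul_amb2Right_comm (a : A) (b : B) :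
    (amb2Left a * amb2Right b : Amb2 A B) = amb2Right b * amb2Left a := by
  refine Fam.ext fun p => ?_
  change opTensor (p.1.π a) 1 * opTensor 1 (p.2.π b) = opTensor 1 (p.2.π b) * opTensor (p.1.π a) 1
  rw [← opTensor_mul, ← opTensor_mul, mul_one, one_mul, mul_one, one_mul]

/-- The two legs commute, so the middle factors can be exchanged. -/
theorem tmul_mul_tmul (a a' : A) (b b' : B) :
    tmul a b * tmul a' b' = tmul (a * a') (b * b') := by
  refine Subtype.ext ?_
  change amb2Left a * amb2Right b * (amb2Left a' * amb2Right b') =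
    amb2Left (a * a') * amb2Right (b * b')
  rw [_root_.map_mul, _root_.map_mul, mul_assoc, ← mul_assoc (amb2Right b),
    ← amb2Left_mul_amb2Right_comm, mul_assoc, mul_assoc]

theorem star_tmul (a : A) (b : B) : star (tmul a b) = tmul (star a) (star b) := by
  refine Subtype.ext ?_
  change star (amb2Left a * amb2Right b) = amb2Left (star a) * amb2Right (star b)
  rw [star_mul, ← map_star, ← map_star, amb2Left_mul_amb2Right_comm]

theorem tmul_one_one : (tmul 1 1 : MinTensor A B) = 1 := by
  refine Subtype.ext ?_
  change (amb2Left (1 : A) * amb2Right (1 : B) : Amb2 A B) = 1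
  rw [_root_.map_one, _root_.map_one, mul_one]

variable (A B) in
/-- The elementary tensors, as a submonoid of `A ⊗ B`. -/
def tmulSubmonoid : Submonoid (MinTensor A B) where
  carrier := {t | ∃ a b, t = tmul a b}
  mul_mem' := by
    rintro _ _ ⟨a, b, rfl⟩ ⟨a', b', rfl⟩
    exact ⟨a * a', b * b', tmul_mul_tmul a a' b b'⟩
  one_mem' := ⟨1, 1, tmul_one_one.symm⟩

variable (A B) in
/-- The linear combinations of elementary tensors are dense in `A ⊗ B`. -/
theorem dense_span_tmul :
    Dense (Submodule.span ℂ {t : MinTensor A B | ∃ a b, t = tmul a b} : Set (MinTensor A B)) := by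
  have hspan : Subalgebra.toSubmodule (StarAlgebra.adjoin ℂ
      {t : MinTensor A B | ∃ a b, t = tmul a b}).toSubalgebra =
        Submodule.span ℂ {t : MinTensor A B | ∃ a b, t = tmul a b} := by
    rw [StarAlgebra.adjoin_eq_span]
    have hstar : star {t : MinTensor A B | ∃ a b, t = tmul a b} ⊆
        {t : MinTensor A B | ∃ a b, t = tmul a b} := by
      rintro t ⟨a, b, h⟩
      exact ⟨star a, star b, by rw [← star_tmul, ← h, star_star]⟩
    -- Elementary tensors are already closed under adjoints and products, so generating a
    -- `*`-algebra from them only adds linear combinations.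
    rw [Set.union_eq_left.mpr hstar]
    congr 1
    exact congrArg SetLike.coe (Submonoid.closure_eq (tmulSubmonoid A B))
  intro t
  have h := mem_of_tmul_mem (StarAlgebra.adjoin ℂ
    {t : MinTensor A B | ∃ a b, t = tmul a b}).topologicalClosure
    (StarSubalgebra.isClosed_topologicalClosure _)
    (fun a b => StarSubalgebra.le_topologicalClosure _
      (StarAlgebra.subset_adjoin _ _ ⟨a, b, rfl⟩)) t
  rw [← hspan]
  exact h

end MinTensor

/-! ### Contractivity of product states. -/

section State

variable {A B : Type u} [CStarAlgebra A] [CStarAlgebra B]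

theorem State.norm_vec (φ : State A) : ‖φ.vec‖ = 1 := by
  have h := φ.inner_vec 1
  rw [_root_.map_one, one_apply_eq_self, State.map_one, inner_self_eq_norm_sq_to_K] at h
  have h' : ‖φ.vec‖ ^ 2 = 1 := Complex.ofReal_injective (by rw [Complex.ofReal_pow]; exact h)
  exact (pow_eq_one_iff_of_nonneg (norm_nonneg _) two_ne_zero).mp h'

/-- The product state is the vector state of a unit vector in a representation of `A ⊗ B`. The
constant `1` does not depend on the states, which makes the later approximations uniform in them. -/
theorem State.norm_prod_apply_le (φ : State A) (ψ : State B) (t : MinTensor A B) :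
    ‖(φ.prod ψ).toFun t‖ ≤ ‖t‖ := by
  change ‖inner ℂ (Hilb.tmul φ.vec ψ.vec)
    (evalAt φ.rep ψ.rep t (Hilb.tmul φ.vec ψ.vec))‖ ≤ _
  have h1 : ‖Hilb.tmul φ.vec ψ.vec‖ = 1 := by
    refine (norm_htmul φ.vec ψ.vec).trans ?_
    rw [φ.norm_vec, ψ.norm_vec, one_mul]
  refine (norm_inner_le_norm (𝕜 := ℂ) _ _).trans ?_
  rw [h1, one_mul]
  refine (ContinuousLinearMap.le_of_opNorm_le _
    (NonUnitalStarAlgHom.norm_apply_le (evalAt φ.rep ψ.rep) t) _).trans_eq ?_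
  rw [h1, mul_one]

end State

/-! ### Slicing by a state, and `μ ◁ ψ` as a barycenter. -/

section Measure

variable {X : Type u} [MetricSpace X] [CompactSpace X] [MeasurableSpace X] [BorelSpace X]
  {A : Type u} [CStarAlgebra A]

theorem State.ofMeasure_diracProba_apply (x : X) (f : C(X, ℂ)) :
    (State.ofMeasure (diracProba x)).toFun f = f x :=
  integral_dirac _ _

/-- For `t = f ⊗ a` the slice is `x ↦ f(x) ψ(a)`, and both properties are linear in `t`. They are
proved together because adding integrals requires integrability, which continuity supplies. -/
theorem continuous_prod_dirac_and_integral (ψ : State A) {t : MinTensor C(X, ℂ) A}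
    (ht : t ∈ Submodule.span ℂ {t : MinTensor C(X, ℂ) A | ∃ f a, t = tmul f a}) :
    Continuous (fun x => ((State.ofMeasure (diracProba x)).prod ψ).toFun t) ∧
      ∀ μ : ProbabilityMeasure X, ((State.ofMeasure μ).prod ψ).toFun t =
        ∫ x, ((State.ofMeasure (diracProba x)).prod ψ).toFun t ∂(μ : Measure X) := by
  have hint : ∀ {g : X → ℂ} (μ : ProbabilityMeasure X), Continuous g →
      Integrable g (μ : Measure X) := fun μ hg =>
    hg.integrable_of_hasCompactSupport (HasCompactSupport.of_compactSpace _)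
  induction ht using Submodule.span_induction with
  | mem t ht =>
    obtain ⟨f, a, rfl⟩ := ht
    simp only [State.prod_tmul, State.ofMeasure_diracProba_apply]
    exact ⟨by fun_prop, fun μ => (integral_mul_const _ _).symm⟩
  | zero => simp only [map_zero, integral_zero]; exact ⟨continuous_const, fun _ => trivial⟩
  | add s t _ _ hs ht =>
    simp only [_root_.map_add]
    refine ⟨hs.1.add ht.1, fun μ => ?_⟩
    rw [integral_add (hint μ hs.1) (hint μ ht.1), hs.2, ht.2]
  | smul c t _ ht =>
    simp only [_root_.map_smul]
    refine ⟨ht.1.const_smul c, fun μ => ?_⟩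
    rw [integral_smul, ht.2]

/-- One approximant serves all `μ` and `ψ` at once, since product states do not increase the norm of
the difference. -/
theorem exists_mem_span_tmul_dist_lt (t : MinTensor C(X, ℂ) A) {ε : ℝ} (hε : 0 < ε) :
    ∃ s ∈ Submodule.span ℂ {t : MinTensor C(X, ℂ) A | ∃ f a, t = tmul f a},
      ∀ (μ : ProbabilityMeasure X) (ψ : State A), dist (((State.ofMeasure μ).prod ψ).toFun t)
        (((State.ofMeasure μ).prod ψ).toFun s) < ε := by
  obtain ⟨s, hs, h⟩ := (dense_span_tmul C(X, ℂ) A).exists_dist_lt t hε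
  refine ⟨s, hs, fun μ ψ => ?_⟩
  rw [dist_eq_norm, ← _root_.map_sub]
  exact (State.norm_prod_apply_le _ _ _).trans_lt (by rwa [← dist_eq_norm])

/-- The function `(id ⊗ ψ)(t)` on `X` is continuous. -/
theorem continuous_prod_dirac (ψ : State A) (t : MinTensor C(X, ℂ) A) :
    Continuous fun x => ((State.ofMeasure (diracProba x)).prod ψ).toFun t := by
  -- The slices of elements of the span are continuous and approximate this one uniformly in `x`.
  refine continuous_of_uniform_approx_of_continuous fun u hu => ?_
  obtain ⟨ε, hε, hu⟩ := Metric.mem_uniformity_dist.mp hu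
  obtain ⟨s, hs, h⟩ := exists_mem_span_tmul_dist_lt t hε
  exact ⟨_, (continuous_prod_dirac_and_integral ψ hs).1, fun x => hu (h _ ψ)⟩

/-- A Fubini formula: both sides agree on the span of elementary tensors, and replacing `t` by a
nearby element of it costs at most `ε / 2` on each side. -/
theorem prod_ofMeasure_apply (μ : ProbabilityMeasure X) (ψ : State A) (t : MinTensor C(X, ℂ) A) :
    ((State.ofMeasure μ).prod ψ).toFun t =
      ∫ x, ((State.ofMeasure (diracProba x)).prod ψ).toFun t ∂(μ : Measure X) := by
  have hint : ∀ t, Integrable (fun x => ((State.ofMeasure (diracProba x)).prod ψ).toFun t)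
      (μ : Measure X) := fun t =>
    (continuous_prod_dirac ψ t).integrable_of_hasCompactSupport
      (HasCompactSupport.of_compactSpace _)
  refine eq_of_forall_dist_le fun ε hε => ?_
  obtain ⟨s, hs, h⟩ := exists_mem_span_tmul_dist_lt (X := X) t (half_pos hε)
  refine (dist_triangle_right _ _ (((State.ofMeasure μ).prod ψ).toFun s)).trans ?_
  rw [← add_halves ε]
  refine add_le_add (h μ ψ).le ?_
  rw [(continuous_prod_dirac_and_integral ψ hs).2 μ, dist_eq_norm, ← integral_sub (hint t) (hint s)]
  refine (norm_integral_le_of_norm_le_const (C := ε / 2) (.of_forall fun x => ?_)).trans_eq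
    (by simp)
  rw [← dist_eq_norm]
  exact (h _ ψ).le

variable {G : QuantumGroup A}

open BoundedContinuousFunction in
-- Weak convergence and marginals are tested on real functions, while the action lives on complex
-- ones; this is the bridge.
theorem Action.integral_act_ofReal (α : Action G X) (μ : ProbabilityMeasure X) (ψ : State A)
    (f : X →ᵇ ℝ) :
    ((∫ x, f x ∂(α.act μ ψ : Measure X) : ℝ) : ℂ) = ((State.ofMeasure μ).prod ψ).toFun
      (α.ρ ⟨fun x => (f x : ℂ), by fun_prop⟩) := by
  rw [← α.integral_act, ← integral_complex_ofReal]
  rfl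

theorem Action.continuous_act_diracProba (α : Action G X) (ψ : State A) :
    Continuous fun x => α.act (diracProba x) ψ := by
  refine continuous_iff_continuousAt.mpr fun x =>
    ProbabilityMeasure.tendsto_iff_forall_integral_tendsto.mpr fun f => ?_
  refine Complex.isUniformEmbedding_ofReal.isEmbedding.tendsto_nhds_iff.mpr ?_
  simp only [Function.comp_def, α.integral_act_ofReal]
  exact (continuous_prod_dirac ψ _).tendsto x

open BoundedContinuousFunction in
/-- The measure `μ ◁ ψ` is the barycenter of the measures `x ◁ ψ`. -/
theorem Action.integral_act_eq_integral_integral (α : Action G X) (μ : ProbabilityMeasure X)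
    (ψ : State A) (f : X →ᵇ ℝ) :
    ∫ x, f x ∂(α.act μ ψ : Measure X) =
      ∫ x, ∫ y, f y ∂(α.act (diracProba x) ψ : Measure X) ∂(μ : Measure X) := by
  apply Complex.ofReal_injective
  rw [α.integral_act_ofReal, prod_ofMeasure_apply, ← integral_complex_ofReal]
  simp only [α.integral_act_ofReal]

end Measure

end CQG

/-! ### The equivalence. -/

theorem mainTheorem8 {X : Type u} [MetricSpace X] [CompactSpace X] [MeasurableSpace X]
    [BorelSpace X] {A : Type u} [CStarAlgebra A] (G : CQG.QuantumGroup A) (α : CQG.Action G X)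
    (p : ℝ) (hp : 1 ≤ p) :
    α.Lip p ↔ ∀ (x y : X) (ψ : CQG.State A),
      CQG.wasserstein p (α.act (diracProba x) ψ) (α.act (diracProba y) ψ) ≤ dist x y := by
  have hp0 : 0 < p := zero_lt_one.trans_le hp
  refine ⟨fun h x y ψ => (h _ _ ψ).trans (CQG.wasserstein_diracProba_le hp0 x y),
    fun h μ ν ψ => ?_⟩
  exact CQG.wasserstein_barycenter_le hp0 (α.continuous_act_diracProba ψ) (fun x y => h x y ψ)
    (α.integral_act_eq_integral_integral μ ψ) (α.integral_act_eq_integral_integral ν ψ)
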